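/- Let $1\le m\le n$, let $X\subset\mathbb C^n$ be compact, and let $\phi:X\to\mathbb R$ be lower semicontinuous. Here a subharmonic function $u$ on an open set $U\subset\mathbb C^n$ (upper semicontinuous, with values in $[-\infty,\infty)$, not identically $-\infty$ on any component) is called $m$-subharmonic if $dd^c u\wedge\alpha_1\wedge\dots\wedge\alpha_{m-1}\wedge\beta^{n-m}\ge 0$ in the sense of currents for all real $(1,1)$-forms $\alpha_1,\dots,\alpha_{m-1}$ with constant coefficients satisfying $\alpha_j^k\wedge\beta^{n-k}\ge0$ for $k=1,\dots,m$, where $\beta=dd^c|z|^2$. Let $\mathcal{SH}_m^o(X)$ be the set of restrictions to $X$ of real-valued functions that are continuous and $m$-subharmonic on some open neighborhood of $X$. For $z\in X$ let $\mathcal J_z^m(X)$ be the set of regular Borel probability measures $\mu$ on $X$ with $u(z)\le\int_X u\,d\mu$ for all $u\in\mathcal{SH}_m^o(X)$. Let $\mathcal{SH}_m(X)$ be the set of upper semicontinuous functions $u:X\to[-\infty,\infty)$ such that $u(z)\le\int_X u\,d\mu$ for all $z\in X$ and all $\mu\in\mathcal J_z^m(X)$. Finally, let $\mathcal C(X)$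 be the set of real-valued continuous functions on $X$. (Integrals of semicontinuous functions may take the values $\pm\infty$.) Then for every $z\in X$: (a) $$\sup\{\psi(z):\psi\in\mathcal{SH}_m^o(X),\ \psi\le\phi\}=\inf\Big\{\int_X\phi\,d\mu:\mu\in\mathcal J_z^m(X)\Big\};$$ (b) $$\sup\{\psi(z):\psi\in\mathcal{SH}_m(X)\cap\mathcal C(X),\ \psi\le\phi\}=\sup\{\psi(z):\psi\in\mathcal{SH}_m(X),\ \psi\le\phi\}=\inf\Big\{\int_X\phi\,d\mu:\mu\in\mathcal J_z^m(X)\Big\}.$$ -/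

import Mathlib

open MeasureTheory Topology
open scoped ContDiff

noncomputable section

namespace MSH

/-- Integral, with values in `[-∞, +∞]`, of an extended-real-valued function: integral of the
positive part minus integral of the negative part.  It is the usual integral as soon as one of the
two parts has finite integral, in particular for semicontinuous functions that are bounded from
above or from below, with respect to a finite measure. -/
def eintegral {α : Type*} [MeasurableSpace α] (μ : Measure α) (f : α → EReal) : EReal :=
  ((∫⁻ x, (f x).toENNReal ∂μ : ENNReal) : EReal) - ((∫⁻ x, (-f x).toENNReal ∂μ : ENNReal) : EReal)

variable {n : ℕ}

/-- Wirtinger derivative `∂f/∂z_j = (∂f/∂x_j - i ∂f/∂y_j) / 2`. -/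
def dz (j : Fin n) (f : (Fin n → ℂ) → ℂ) (z : Fin n → ℂ) : ℂ :=
  (fderiv ℝ f z (Pi.single j 1) - Complex.I * fderiv ℝ f z (Pi.single j Complex.I)) / 2

/-- Wirtinger derivative `∂f/∂z̄_j = (∂f/∂x_j + i ∂f/∂y_j) / 2`. -/
def dzbar (j : Fin n) (f : (Fin n → ℂ) → ℂ) (z : Fin n → ℂ) : ℂ :=
  (fderiv ℝ f z (Pi.single j 1) + Complex.I * fderiv ℝ f z (Pi.single j Complex.I)) / 2

/-- The complex Hessian `(∂²f/∂z_j∂z̄_k)`: up to a positive factor, the coefficient matrix of the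
(1,1)-form `ddᶜ f`. -/
def complexHessian (f : (Fin n → ℂ) → ℝ) (z : Fin n → ℂ) : Matrix (Fin n) (Fin n) ℂ :=
  Matrix.of fun j k => dz j (dzbar k fun w => (f w : ℂ)) z

/-- The wedge product of `n` (1,1)-forms on `ℂⁿ`.  A (1,1)-form `(i/2) ∑ a_{jk} dz_j ∧ dz̄_k` is
represented by its coefficient matrix, and the (n,n)-form `α_1 ∧ … ∧ α_n` by its coefficient with
respect to the Euclidean volume form, which is obtained by expanding the product. -/
def wedge (A : Fin n → Matrix (Fin n) (Fin n) ℂ) : ℂ :=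
  ∑ σ : Equiv.Perm (Fin n), ∑ τ : Equiv.Perm (Fin n),
    ((Equiv.Perm.sign σ : ℤ) : ℂ) * ((Equiv.Perm.sign τ : ℤ) : ℂ) * ∏ l, A l (σ l) (τ l)

/-- The cone of real (1,1)-forms `α` with constant coefficients (Hermitian coefficient matrices)
such that `α ^ k ∧ β ^ (n - k) ≥ 0` for `k = 1, …, m`, where `β` is the standard Kähler form, whose
coefficient matrix is the identity. -/
def gammaCone (n m : ℕ) : Set (Matrix (Fin n) (Fin n) ℂ) :=
  {A | A.IsHermitian ∧ ∀ k, 1 ≤ k → k ≤ m →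
    0 ≤ (wedge fun l : Fin n => if (l : ℕ) < k then A else 1).re}

/-- Closed Euclidean ball in `ℂⁿ`. -/
def closedBall (z : Fin n → ℂ) (r : ℝ) : Set (Fin n → ℂ) :=
  {w | ∑ j, ‖w j - z j‖ ^ 2 ≤ r ^ 2}

/-- Subharmonic functions `u : U → [-∞, ∞)` on an open set `U` of `ℂⁿ`: upper semicontinuous,
locally integrable (that is, not identically `-∞` on a component of `U`) and satisfying the
sub-mean value inequality on balls.  The values of `u` outside `U` play no role. -/
structure IsSubharmonicOn (u : (Fin n → ℂ) → EReal) (U : Set (Fin n → ℂ)) : Prop where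
  upperSemicontinuousOn : UpperSemicontinuousOn u U
  lt_top : ∀ z ∈ U, u z < ⊤
  ae_ne_bot : ∀ᵐ z ∂(volume.restrict U), u z ≠ ⊥
  locallyIntegrableOn : LocallyIntegrableOn (fun z => (u z).toReal) U
  le_mean : ∀ z r, 0 < r → closedBall z r ⊆ U →
    u z ≤ eintegral (ProbabilityTheory.cond volume (closedBall z r)) u

/-- `m`-subharmonic functions on an open set `U` of `ℂⁿ`: subharmonic functions `u` such that
`ddᶜ u ∧ α_1 ∧ … ∧ α_{m-1} ∧ β ^ (n - m) ≥ 0` in the sense of currents for all constant forms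
`α_1, …, α_{m-1}` in the cone `gammaCone n m`, that is
`∫ u ddᶜ χ ∧ α_1 ∧ … ∧ α_{m-1} ∧ β ^ (n - m) ≥ 0` for all nonnegative test functions `χ` on `U`.
(Of the family `α` only the members with index `1, …, m - 1` are used.) -/
structure IsMSubharmonicOn (m : ℕ) (u : (Fin n → ℂ) → EReal) (U : Set (Fin n → ℂ)) : Prop where
  isSubharmonicOn : IsSubharmonicOn u U
  ddc_wedge_nonneg : ∀ α : Fin n → Matrix (Fin n) (Fin n) ℂ, (∀ l, α l ∈ gammaCone n m) →
    ∀ χ : (Fin n → ℂ) → ℝ, ContDiff ℝ ∞ χ → HasCompactSupport χ → tsupport χ ⊆ U →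
      (∀ z, 0 ≤ χ z) →
      0 ≤ ∫ z, (u z).toReal * (wedge fun l : Fin n =>
        if (l : ℕ) = 0 then complexHessian χ z else if (l : ℕ) < m then α l else 1).re

/-- `SH_m^o(X)`: restrictions to `X` of (real-valued) continuous `m`-subharmonic functions defined
on some open neighbourhood of `X`. -/
def SHo (m : ℕ) (X : Set (Fin n → ℂ)) : Set (X → ℝ) :=
  {ψ | ∃ (U : Set (Fin n → ℂ)) (v : (Fin n → ℂ) → ℝ), IsOpen U ∧ X ⊆ U ∧ ContinuousOn v U ∧
    IsMSubharmonicOn m (fun z => (v z : EReal)) U ∧ ∀ x : X, ψ x = v x}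

/-- `J_z^m(X)`: the Jensen measures with barycenter `z` with respect to `SH_m^o(X)`.
(Borel probability measures on a compact subset of `ℂⁿ` are regular.) -/
def jensen (m : ℕ) (X : Set (Fin n → ℂ)) (z : X) : Set (ProbabilityMeasure X) :=
  {μ | ∀ u ∈ SHo m X, u z ≤ ∫ x, u x ∂(μ : Measure X)}

/-- `SH_m(X)`: the upper semicontinuous functions `u : X → [-∞, ∞)` with `u z ≤ ∫ u dμ` for all
`z` in `X` and all Jensen measures `μ` with barycenter `z`. -/
def SH (m : ℕ) (X : Set (Fin n → ℂ)) : Set (X → EReal) :=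
  {u | UpperSemicontinuous u ∧ (∀ x, u x < ⊤) ∧
    ∀ z, ∀ μ ∈ jensen m X z, u z ≤ eintegral (μ : Measure X) u}

end MSH

end

/-! Write `S₀`, `S₁`, `S₂` for the suprema over `SHo`, over continuous members of `SH`, and over
`SH`, and `I` for the infimum over Jensen measures. Then `S₀ ≤ S₁ ≤ S₂ ≤ I` is soft: members of
`SHo` are continuous and lie in `SH`, and the last step integrates `ψ ≤ φ` against a Jensen measure.
The content is `I ≤ S₀`, an instance of Edwards' theorem, which uses only that `SHo` is a convex
cone of continuous functions containing the constants (`isConeWithConstants_SHo`).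

For continuous `f` (`exists_integral_le`), `N g = -sup {u z | u ∈ F, u ≤ -g}` is sublinear.
Hahn-Banach gives a linear `L ≤ N` with `L (-f) = N (-f)`. Domination by `N` makes `L` positive and
normalized with `u z ≤ L u` on `F`, so by Riesz it is a Jensen measure at which `∫ f` equals the
supremum. A lower semicontinuous `φ` is an increasing limit of continuous functions. Weak
compactness of the probability measures yields one measure that serves all of them, and monotone
convergence passes to `φ`. -/

noncomputable section

namespace MSH

/-! ### Extended-real integrals -/

section Integral

variable {α : Type*} [MeasurableSpace α] {μ : Measure α}

lemma eintegral_mono {f g : α → EReal} (h : ∀ x, f x ≤ g x) : eintegral μ f ≤ eintegral μ g := by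
  refine EReal.sub_le_sub ?_ ?_
  · exact EReal.coe_ennreal_le_coe_ennreal_iff.2
      (lintegral_mono fun x => EReal.toENNReal_le_toENNReal (h x))
  · exact EReal.coe_ennreal_le_coe_ennreal_iff.2
      (lintegral_mono fun x => EReal.toENNReal_le_toENNReal (EReal.neg_le_neg_iff.2 (h x)))

lemma eintegral_coe {f : α → ℝ} (hf : Integrable f μ) :
    eintegral μ (fun x => (f x : EReal)) = ((∫ x, f x ∂μ : ℝ) : EReal) := by
  have h1 : (∫⁻ x, ENNReal.ofReal (f x) ∂μ) ≠ ⊤ := hf.lintegral_lt_top.ne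
  have h2 : (∫⁻ x, ENNReal.ofReal (-f x) ∂μ) ≠ ⊤ := hf.neg.lintegral_lt_top.ne
  rw [integral_eq_lintegral_pos_part_sub_lintegral_neg_part hf, EReal.coe_sub,
    EReal.coe_ennreal_toReal h1, EReal.coe_ennreal_toReal h2]
  simp only [eintegral, ← EReal.coe_neg, EReal.real_coe_toENNReal]

end Integral

variable {n : ℕ}

/-! ### Euclidean balls -/

section Ball

/-- `Fin n → ℂ` carries the sup norm, so this is not a metric ball; boundedness comes from inclusion
in a polydisc. -/
lemma isCompact_closedBall (z : Fin n → ℂ) (r : ℝ) : IsCompact (closedBall z r) := by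
  refine Metric.isCompact_of_isClosed_isBounded ?_ ?_
  · exact isClosed_le (by fun_prop) continuous_const
  · refine (Metric.isBounded_closedBall (x := z) (r := |r|)).subset fun w hw => ?_
    rw [Metric.mem_closedBall, dist_pi_le_iff (abs_nonneg r)]
    intro j
    rw [dist_eq_norm, ← abs_of_nonneg (norm_nonneg (w j - z j))]
    exact sq_le_sq.1 ((Finset.single_le_sum (f := fun j => ‖w j - z j‖ ^ 2)
      (fun _ _ => by positivity) (Finset.mem_univ j)).trans hw)

lemma volume_closedBall_ne_zero (z : Fin n → ℂ) {r : ℝ} (hr : 0 < r) :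
    volume (closedBall z r) ≠ 0 := by
  have ho : IsOpen {w : Fin n → ℂ | ∑ j, ‖w j - z j‖ ^ 2 < r ^ 2} :=
    isOpen_lt (by fun_prop) continuous_const
  have hz : z ∈ {w : Fin n → ℂ | ∑ j, ‖w j - z j‖ ^ 2 < r ^ 2} := by
    simpa using pow_pos hr 2
  intro h
  exact ho.measure_ne_zero volume ⟨z, hz⟩
    (measure_mono_null (Set.ofPred_subset_ofPred.2 fun w hw => hw.le) h)

lemma integrable_cond_closedBall {v : (Fin n → ℂ) → ℝ} {z : Fin n → ℂ} {r : ℝ} (hr : 0 < r)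
    (hv : ContinuousOn v (closedBall z r)) :
    Integrable v (ProbabilityTheory.cond volume (closedBall z r)) :=
  (hv.integrableOn_compact (isCompact_closedBall z r)).smul_measure
    (ENNReal.inv_ne_top.2 (volume_closedBall_ne_zero z hr))

end Ball

/-! ### Wirtinger derivatives of test functions -/

section Wirtinger

variable {f : (Fin n → ℂ) → ℂ}

lemma contDiff_fderiv_const (hf : ContDiff ℝ ∞ f) (v : Fin n → ℂ) :
    ContDiff ℝ ∞ fun z => fderiv ℝ f z v :=
  (hf.fderiv_right (m := ∞) (by simp)).clm_apply contDiff_const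

lemma contDiff_dz (hf : ContDiff ℝ ∞ f) (j : Fin n) : ContDiff ℝ ∞ (dz j f) :=
  ((contDiff_fderiv_const hf _).sub
    (contDiff_const.mul (contDiff_fderiv_const hf _))).div_const _

lemma contDiff_dzbar (hf : ContDiff ℝ ∞ f) (j : Fin n) : ContDiff ℝ ∞ (dzbar j f) :=
  ((contDiff_fderiv_const hf _).add
    (contDiff_const.mul (contDiff_fderiv_const hf _))).div_const _

lemma tsupport_dz_subset (j : Fin n) (f : (Fin n → ℂ) → ℂ) : tsupport (dz j f) ⊆ tsupport f := by
  refine closure_minimal (fun z hz => ?_) (isClosed_tsupport f)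
  by_contra h
  have : fderiv ℝ f z = 0 := by
    simpa using fun h' => h (support_fderiv_subset ℝ (f := f) h')
  exact hz (by simp [dz, this])

lemma tsupport_dzbar_subset (j : Fin n) (f : (Fin n → ℂ) → ℂ) :
    tsupport (dzbar j f) ⊆ tsupport f := by
  refine closure_minimal (fun z hz => ?_) (isClosed_tsupport f)
  by_contra h
  have : fderiv ℝ f z = 0 := by
    simpa using fun h' => h (support_fderiv_subset ℝ (f := f) h')
  exact hz (by simp [dzbar, this])

lemma integral_fderiv_eq_zero (hf : ContDiff ℝ ∞ f) (hc : HasCompactSupport f) (v : Fin n → ℂ) :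
    Integrable (fun z => fderiv ℝ f z v) ∧ ∫ z, fderiv ℝ f z v = 0 := by
  have hi : Integrable (fun z => fderiv ℝ f z v) :=
    (contDiff_fderiv_const hf v).continuous.integrable_of_hasCompactSupport
      (hc.fderiv_apply (𝕜 := ℝ) v)
  refine ⟨hi, ?_⟩
  -- Integration by parts against the constant `1`, whose derivative vanishes.
  have := integral_mul_fderiv_eq_neg_fderiv_mul_of_integrable (μ := volume) (𝕜 := ℂ)
    (f := fun _ : Fin n → ℂ => (1 : ℂ)) (g := f) (v := v) (by simp) (by simpa using hi)
    (by simpa using hf.continuous.integrable_of_hasCompactSupport hc)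
    (fun _ _ => differentiableAt_const _) (fun x _ => hf.differentiable (by simp) x)
  simpa using this

lemma integral_dz_eq_zero (hf : ContDiff ℝ ∞ f) (hc : HasCompactSupport f) (j : Fin n) :
    ∫ z, dz j f z = 0 := by
  obtain ⟨h1, h1'⟩ := integral_fderiv_eq_zero hf hc (Pi.single j 1)
  obtain ⟨h2, h2'⟩ := integral_fderiv_eq_zero hf hc (Pi.single j Complex.I)
  simp only [dz]
  rw [integral_div, integral_sub h1 (h2.const_mul _), integral_const_mul, h1', h2']
  simp

end Wirtinger

/-! ### The density of the wedge product with a complex Hessian -/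

section Hessian

variable {χ : (Fin n → ℂ) → ℝ}

lemma contDiff_complexHessian (hχ : ContDiff ℝ ∞ χ) (j k : Fin n) :
    ContDiff ℝ ∞ fun z => complexHessian χ z j k :=
  contDiff_dz (contDiff_dzbar (Complex.ofRealCLM.contDiff.comp hχ) k) j

lemma tsupport_complexHessian_subset (χ : (Fin n → ℂ) → ℝ) (j k : Fin n) :
    tsupport (fun z => complexHessian χ z j k) ⊆ tsupport χ :=
  ((tsupport_dz_subset j _).trans (tsupport_dzbar_subset k _)).trans
    (tsupport_comp_subset (g := ((↑) : ℝ → ℂ)) Complex.ofReal_zero χ)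

lemma integral_complexHessian_eq_zero (hχ : ContDiff ℝ ∞ χ) (hc : HasCompactSupport χ)
    (j k : Fin n) : ∫ z, complexHessian χ z j k = 0 := by
  have hd : ContDiff ℝ ∞ fun w => (χ w : ℂ) := Complex.ofRealCLM.contDiff.comp hχ
  refine integral_dz_eq_zero (contDiff_dzbar hd k) ?_ j
  exact hc.of_isClosed_subset (isClosed_tsupport _) ((tsupport_dzbar_subset k _).trans
    (tsupport_comp_subset (g := ((↑) : ℝ → ℂ)) Complex.ofReal_zero χ))

/-- The density of `ddᶜ χ ∧ α_1 ∧ … ∧ α_{m-1} ∧ β ^ (n - m)`. -/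
def hessianDensity (m : ℕ) (α : Fin n → Matrix (Fin n) (Fin n) ℂ) (χ : (Fin n → ℂ) → ℝ)
    (z : Fin n → ℂ) : ℝ :=
  (wedge fun l : Fin n =>
    if (l : ℕ) = 0 then complexHessian χ z else if (l : ℕ) < m then α l else 1).re

/-- The wedge is linear in slot `0`. The coefficients depend only on the constant forms in the other
slots, so `hessianDensity` is a constant-coefficient combination of Hessian entries. -/
lemma exists_wedge_eq_sum (hn : 0 < n) (m : ℕ) (α : Fin n → Matrix (Fin n) (Fin n) ℂ) :
    ∃ C : Equiv.Perm (Fin n) → Equiv.Perm (Fin n) → ℂ, ∀ H : Matrix (Fin n) (Fin n) ℂ,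
      (wedge fun l : Fin n => if (l : ℕ) = 0 then H else if (l : ℕ) < m then α l else 1) =
        ∑ σ : Equiv.Perm (Fin n), ∑ τ : Equiv.Perm (Fin n), C σ τ * H (σ ⟨0, hn⟩) (τ ⟨0, hn⟩) := by
  refine ⟨fun σ τ => ((Equiv.Perm.sign σ : ℤ) : ℂ) * ((Equiv.Perm.sign τ : ℤ) : ℂ) *
    ∏ l ∈ Finset.univ.erase (⟨0, hn⟩ : Fin n),
      (if (l : ℕ) < m then α l else 1) (σ l) (τ l), fun H => ?_⟩
  refine Finset.sum_congr rfl fun σ _ => Finset.sum_congr rfl fun τ _ => ?_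
  rw [← Finset.mul_prod_erase _ _ (Finset.mem_univ (⟨0, hn⟩ : Fin n))]
  have : ∀ l ∈ Finset.univ.erase (⟨0, hn⟩ : Fin n),
      (if (l : ℕ) = 0 then H else if (l : ℕ) < m then α l else 1) (σ l) (τ l) =
        (if (l : ℕ) < m then α l else 1) (σ l) (τ l) := by
    intro l hl
    rw [if_neg fun h => Finset.ne_of_mem_erase hl (Fin.ext h)]
  rw [Finset.prod_congr rfl this]
  simp only [if_true]
  ring

lemma continuous_hessianDensity (hn : 0 < n) (m : ℕ) (α : Fin n → Matrix (Fin n) (Fin n) ℂ)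
    (hχ : ContDiff ℝ ∞ χ) : Continuous (hessianDensity m α χ) := by
  obtain ⟨C, hC⟩ := exists_wedge_eq_sum hn m α
  simp only [funext fun z => show hessianDensity m α χ z = _ from congrArg Complex.re (hC _)]
  exact Complex.continuous_re.comp <| continuous_finsetSum _ fun σ _ =>
    continuous_finsetSum _ fun τ _ =>
      continuous_const.mul (contDiff_complexHessian hχ _ _).continuous

lemma hessianDensity_eq_zero (hn : 0 < n) (m : ℕ) (α : Fin n → Matrix (Fin n) (Fin n) ℂ)
    {z : Fin n → ℂ} (hz : z ∉ tsupport χ) : hessianDensity m α χ z = 0 := by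
  obtain ⟨C, hC⟩ := exists_wedge_eq_sum hn m α
  have h0 : ∀ j k, complexHessian χ z j k = 0 := fun j k =>
    image_eq_zero_of_notMem_tsupport (f := fun z => complexHessian χ z j k)
      fun h => hz (tsupport_complexHessian_subset χ j k h)
  rw [hessianDensity, hC]
  simp [h0]

lemma integral_hessianDensity_eq_zero (hn : 0 < n) (m : ℕ)
    (α : Fin n → Matrix (Fin n) (Fin n) ℂ) (hχ : ContDiff ℝ ∞ χ) (hc : HasCompactSupport χ) :
    ∫ z, hessianDensity m α χ z = 0 := by
  obtain ⟨C, hC⟩ := exists_wedge_eq_sum hn m α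
  have hi : ∀ j k, Integrable fun z => complexHessian χ z j k := fun j k =>
    (contDiff_complexHessian hχ j k).continuous.integrable_of_hasCompactSupport
      (hc.of_isClosed_subset (isClosed_tsupport _) (tsupport_complexHessian_subset χ j k))
  have hs : ∀ σ : Equiv.Perm (Fin n), Integrable fun z =>
      ∑ τ : Equiv.Perm (Fin n), C σ τ * complexHessian χ z (σ ⟨0, hn⟩) (τ ⟨0, hn⟩) := fun σ =>
    integrable_finsetSum _ fun τ _ => (hi _ _).const_mul _
  simp only [hessianDensity, hC]
  have := integral_re (𝕜 := ℂ) (integrable_finsetSum Finset.univ fun σ _ => hs σ)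
  simp only [RCLike.re_to_complex] at this
  rw [this, integral_finsetSum _ fun σ _ => hs σ]
  simp [integral_finsetSum _ fun τ _ => (hi _ _).const_mul _, integral_const_mul,
    integral_complexHessian_eq_zero hχ hc]

lemma integrable_mul_hessianDensity (hn : 0 < n) (m : ℕ)
    (α : Fin n → Matrix (Fin n) (Fin n) ℂ) (hχ : ContDiff ℝ ∞ χ) (hc : HasCompactSupport χ)
    {v : (Fin n → ℂ) → ℝ} (hv : ContinuousOn v (tsupport χ)) :
    Integrable fun z => v z * hessianDensity m α χ z := by
  refine (integrableOn_iff_integrable_of_support_subset (s := tsupport χ) fun z hz => ?_).1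
    ((hv.mul (continuous_hessianDensity hn m α hχ).continuousOn).integrableOn_compact hc)
  by_contra h
  exact hz (by simp [hessianDensity_eq_zero hn m α h])

end Hessian

/-! ### Continuous `m`-subharmonic functions form a convex cone -/

section Cone

variable {m : ℕ} {U : Set (Fin n → ℂ)} {v w : (Fin n → ℂ) → ℝ}

lemma isMSubharmonicOn_coe (hU : IsOpen U) (hv : ContinuousOn v U)
    (hmean : ∀ z r, 0 < r → closedBall z r ⊆ U →
      v z ≤ ∫ x, v x ∂(ProbabilityTheory.cond volume (closedBall z r)))
    (hddc : ∀ α : Fin n → Matrix (Fin n) (Fin n) ℂ, (∀ l, α l ∈ gammaCone n m) →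
      ∀ χ : (Fin n → ℂ) → ℝ, ContDiff ℝ ∞ χ → HasCompactSupport χ → tsupport χ ⊆ U →
        (∀ z, 0 ≤ χ z) → 0 ≤ ∫ z, v z * hessianDensity m α χ z) :
    IsMSubharmonicOn m (fun z => (v z : EReal)) U where
  isSubharmonicOn :=
    { upperSemicontinuousOn :=
        (continuous_coe_real_ereal.comp_continuousOn hv).upperSemicontinuousOn
      lt_top := fun _ _ => EReal.coe_lt_top _
      ae_ne_bot := Filter.Eventually.of_forall fun _ => EReal.coe_ne_bot _
      locallyIntegrableOn := hv.locallyIntegrableOn hU.measurableSet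
      le_mean := fun z r hr h => by
        rw [eintegral_coe (integrable_cond_closedBall hr (hv.mono h))]
        exact EReal.coe_le_coe_iff.2 (hmean z r hr h) }
  -- `(v z : EReal).toReal` is `v z` by definition, and `hessianDensity` unfolds to the wedge.
  ddc_wedge_nonneg := hddc

lemma IsMSubharmonicOn.le_integral (h : IsMSubharmonicOn m (fun z => (v z : EReal)) U)
    (hv : ContinuousOn v U) {z : Fin n → ℂ} {r : ℝ} (hr : 0 < r) (hz : closedBall z r ⊆ U) :
    v z ≤ ∫ x, v x ∂(ProbabilityTheory.cond volume (closedBall z r)) := by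
  have := h.isSubharmonicOn.le_mean z r hr hz
  rwa [eintegral_coe (integrable_cond_closedBall hr (hv.mono hz)), EReal.coe_le_coe_iff] at this

lemma IsMSubharmonicOn.add_coe (hn : 0 < n) {V : Set (Fin n → ℂ)} (hU : IsOpen U) (hV : IsOpen V)
    (hv : ContinuousOn v U) (hw : ContinuousOn w V)
    (h : IsMSubharmonicOn m (fun z => (v z : EReal)) U)
    (h' : IsMSubharmonicOn m (fun z => (w z : EReal)) V) :
    IsMSubharmonicOn m (fun z => ((v z + w z : ℝ) : EReal)) (U ∩ V) := by
  have hv' := hv.mono (Set.inter_subset_left (t := V))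
  have hw' := hw.mono (Set.inter_subset_right (s := U))
  refine isMSubharmonicOn_coe (hU.inter hV) (hv'.add hw') (fun z r hr hz => ?_)
    fun α hα χ hχ hc hs h0 => ?_
  · rw [integral_add (integrable_cond_closedBall hr (hv'.mono hz))
      (integrable_cond_closedBall hr (hw'.mono hz))]
    exact add_le_add (h.le_integral hv hr (hz.trans Set.inter_subset_left))
      (h'.le_integral hw hr (hz.trans Set.inter_subset_right))
  · simp only [add_mul]
    rw [integral_add (integrable_mul_hessianDensity hn m α hχ hc (hv'.mono hs))
      (integrable_mul_hessianDensity hn m α hχ hc (hw'.mono hs))]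
    exact add_nonneg
      (h.ddc_wedge_nonneg α hα χ hχ hc (hs.trans Set.inter_subset_left) h0)
      (h'.ddc_wedge_nonneg α hα χ hχ hc (hs.trans Set.inter_subset_right) h0)

lemma IsMSubharmonicOn.const_mul_coe (hU : IsOpen U) (hv : ContinuousOn v U)
    (h : IsMSubharmonicOn m (fun z => (v z : EReal)) U) {c : ℝ} (hc : 0 ≤ c) :
    IsMSubharmonicOn m (fun z => ((c * v z : ℝ) : EReal)) U := by
  refine isMSubharmonicOn_coe hU (continuousOn_const.mul hv) (fun z r hr hz => ?_)
    fun α hα χ hχ hχc hs h0 => ?_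
  · rw [integral_const_mul]
    exact mul_le_mul_of_nonneg_left (h.le_integral hv hr hz) hc
  · simp only [mul_assoc]
    rw [integral_const_mul]
    exact mul_nonneg hc (h.ddc_wedge_nonneg α hα χ hχ hχc hs h0)

/-- Both conditions hold with equality: a constant is its own mean, and the density of a test
function has integral zero. -/
lemma isMSubharmonicOn_const (hn : 0 < n) (m : ℕ) (c : ℝ) :
    IsMSubharmonicOn m (fun _ : Fin n → ℂ => (c : EReal)) Set.univ := by
  refine isMSubharmonicOn_coe isOpen_univ continuousOn_const (fun z r hr _ => ?_)
    fun α hα χ hχ hc _ _ => ?_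
  · have := ProbabilityTheory.cond_isProbabilityMeasure_of_finite
      (volume_closedBall_ne_zero z hr) (isCompact_closedBall z r).measure_lt_top.ne
    simp
  · rw [integral_const_mul, integral_hessianDensity_eq_zero hn m α hχ hc, mul_zero]

variable {X : Set (Fin n → ℂ)}

lemma continuous_of_mem_SHo {u : X → ℝ} (hu : u ∈ SHo m X) : Continuous u := by
  obtain ⟨U, v, -, hXU, hv, -, h⟩ := hu
  rw [funext h]
  exact continuousOn_iff_continuous_domRestrict.1 (hv.mono hXU)

lemma const_mem_SHo (hn : 0 < n) (m : ℕ) (X : Set (Fin n → ℂ)) (c : ℝ) :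
    (fun _ => c) ∈ SHo m X :=
  ⟨Set.univ, fun _ => c, isOpen_univ, Set.subset_univ X, continuousOn_const,
    isMSubharmonicOn_const hn m c, fun _ => rfl⟩

lemma add_mem_SHo (hn : 0 < n) {u u' : X → ℝ} (hu : u ∈ SHo m X) (hu' : u' ∈ SHo m X) :
    u + u' ∈ SHo m X := by
  obtain ⟨U, v, hU, hXU, hv, hvm, h⟩ := hu
  obtain ⟨V, w, hV, hXV, hw, hwm, h'⟩ := hu'
  exact ⟨U ∩ V, fun z => v z + w z, hU.inter hV, Set.subset_inter hXU hXV,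
    (hv.mono Set.inter_subset_left).add (hw.mono Set.inter_subset_right),
    hvm.add_coe hn hU hV hv hw hwm, fun x => by simp [h, h']⟩

lemma smul_mem_SHo {u : X → ℝ} (hu : u ∈ SHo m X) {c : ℝ} (hc : 0 ≤ c) : c • u ∈ SHo m X := by
  obtain ⟨U, v, hU, hXU, hv, hvm, h⟩ := hu
  exact ⟨U, fun z => c * v z, hU, hXU, continuousOn_const.mul hv, hvm.const_mul_coe hU hv hc,
    fun x => by simp [h]⟩

end Cone

/-! ### Lower semicontinuous functions as increasing limits of continuous ones -/

section Approximation

variable {K : Type*} [TopologicalSpace K] [CompactSpace K]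

lemma exists_le_of_lowerSemicontinuous {φ : K → ℝ} (hφ : LowerSemicontinuous φ) :
    ∃ M, ∀ x, M ≤ φ x := by
  rcases isEmpty_or_nonempty K with h | h
  · exact ⟨0, fun x => h.elim x⟩
  · obtain ⟨a, -, ha⟩ := (hφ.lowerSemicontinuousOn Set.univ).exists_isMinOn Set.univ_nonempty
      isCompact_univ
    exact ⟨φ a, fun x => ha (Set.mem_univ x)⟩

lemma isLUB_continuous_le [T2Space K] {φ : K → ℝ} (hφ : LowerSemicontinuous φ) :
    IsLUB {g : K → ℝ | Continuous g ∧ g ≤ φ} φ := by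
  refine ⟨fun g hg => hg.2, fun b hb x => le_of_forall_lt fun a ha => ?_⟩
  obtain ⟨a', haa', ha'⟩ := exists_between ha
  obtain ⟨M, hM⟩ := exists_le_of_lowerSemicontinuous hφ
  have hclosed : IsClosed {y | φ y ≤ a'} := hφ.isClosed_preimage a'
  obtain ⟨f, hf0, hf1, hf⟩ := exists_continuous_zero_one_of_isClosed hclosed
    (isClosed_singleton (x := x)) (by simpa using ha')
  -- The Urysohn function is rescaled to run from `m` on `{φ ≤ a'}` to `a'` at `x`. It stays below
  -- `φ`: `m ≤ M` handles that set, and off it `φ` exceeds `a'`.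
  set m := min M a'
  have hg : (fun y => m + f y * (a' - m)) ∈ {g : K → ℝ | Continuous g ∧ g ≤ φ} := by
    refine ⟨by fun_prop, fun y => ?_⟩
    by_cases hy : φ y ≤ a'
    · have : f y = 0 := hf0 hy
      simp only [this, zero_mul, add_zero]
      exact (min_le_left M a').trans (hM y)
    · have h1 := (hf y).2
      have h2 : 0 ≤ a' - m := sub_nonneg.2 (min_le_right M a')
      have h3 := not_le.1 hy
      simp only
      nlinarith
  have hfx : f x = 1 := hf1 rfl
  have := hb hg x
  simp only [hfx] at this
  linarith

lemma exists_monotone_continuous_tendsto [T2Space K] [SecondCountableTopology K] {φ : K → ℝ}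
    (hφ : LowerSemicontinuous φ) :
    ∃ g : ℕ → C(K, ℝ), Monotone g ∧ (∀ k x, g k x ≤ φ x) ∧
      ∀ x, Filter.Tendsto (fun k => g k x) Filter.atTop (𝓝 (φ x)) := by
  rcases isEmpty_or_nonempty K with hK | hK
  · exact ⟨fun _ => 0, monotone_const, fun _ x => hK.elim x, fun x => hK.elim x⟩
  obtain ⟨S, hS, hSc, hlub⟩ := exists_countable_lowerSemicontinuous_isLUB
    (fun g (hg : g ∈ {g : K → ℝ | Continuous g ∧ g ≤ φ}) => hg.1.lowerSemicontinuous)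
    (isLUB_continuous_le hφ)
  -- If `S` were empty, `φ - 1` would be an upper bound smaller than the least one.
  have hne : S.Nonempty := by
    by_contra h
    rw [Set.not_nonempty_iff_eq_empty.1 h] at hlub
    obtain ⟨x⟩ := hK
    have := hlub.2 (show (fun y => φ y - 1) ∈ upperBounds ∅ by simp) x
    simp only at this
    linarith
  obtain ⟨f, rfl⟩ := hSc.exists_eq_range hne
  let f' : ℕ → C(K, ℝ) := fun k => ⟨f k, (hS ⟨k, rfl⟩).1⟩
  have hle : ∀ k x, partialSups f' k x ≤ φ x := by
    intro k x
    induction k with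
    | zero => exact (hS ⟨0, rfl⟩).2 x
    | succ k ih =>
      rw [partialSups_add_one, ContinuousMap.sup_apply]
      exact sup_le ih ((hS ⟨k + 1, rfl⟩).2 x)
  refine ⟨partialSups f', (partialSups f').monotone, hle, fun x => ?_⟩
  refine tendsto_atTop_isLUB (fun i j hij => (partialSups f').monotone hij x) ⟨?_, fun b hb => ?_⟩
  · rintro _ ⟨k, rfl⟩
    exact hle k x
  · have := (isLUB_pi.1 hlub x).2
    refine this ?_
    rintro _ ⟨_, ⟨k, rfl⟩, rfl⟩
    exact (le_partialSups f' k x).trans (hb ⟨k, rfl⟩)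

end Approximation

/-! ### Edwards' theorem for cones of continuous functions -/

section Edwards

variable {K : Type*} [TopologicalSpace K]

/-- A convex cone of continuous functions that contains the constants. -/
structure IsConeWithConstants (F : Set (K → ℝ)) : Prop where
  continuous : ∀ u ∈ F, Continuous u
  const_mem : ∀ c : ℝ, (fun _ => c) ∈ F
  add_mem : ∀ u ∈ F, ∀ w ∈ F, u + w ∈ F
  smul_mem : ∀ c : ℝ, 0 ≤ c → ∀ u ∈ F, c • u ∈ F

variable {F : Set (K → ℝ)}

/-- The negatives of the values at `z` of the members of `F` below `-f`. -/
def negMinorantValues (F : Set (K → ℝ)) (z : K) (f : C(K, ℝ)) : Set ℝ :=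
  {t | ∃ u ∈ F, (∀ x, u x ≤ -f x) ∧ t = -u z}

namespace IsConeWithConstants

/-- Together with `negMinorantValues_nonempty`, this makes the real `sInf` a genuine infimum rather
than a default value. -/
lemma bddBelow_negMinorantValues (z : K) (f : C(K, ℝ)) : BddBelow (negMinorantValues F z f) :=
  ⟨f z, by rintro _ ⟨u, -, hu, rfl⟩; linarith [hu z]⟩

lemma sInf_negMinorantValues_le (z : K) {f : C(K, ℝ)} {u : K → ℝ} (hu : u ∈ F)
    (h : ∀ x, u x ≤ -f x) : sInf (negMinorantValues F z f) ≤ -u z :=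
  csInf_le (bddBelow_negMinorantValues z f) ⟨u, hu, h, rfl⟩

variable [CompactSpace K]

lemma negMinorantValues_nonempty (hF : IsConeWithConstants F) (z : K) (f : C(K, ℝ)) :
    (negMinorantValues F z f).Nonempty :=
  ⟨_, _, hF.const_mem (-‖f‖), fun x => neg_le_neg ((le_abs_self _).trans (f.norm_coe_le_norm x)),
    rfl⟩

lemma sInf_negMinorantValues_smul_le (hF : IsConeWithConstants F) (z : K) {c : ℝ} (hc : 0 < c)
    (f : C(K, ℝ)) :
    sInf (negMinorantValues F z (c • f)) ≤ c * sInf (negMinorantValues F z f) := by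
  rw [← div_le_iff₀' hc]
  refine le_csInf (hF.negMinorantValues_nonempty z f) ?_
  rintro _ ⟨u, hu, h, rfl⟩
  rw [div_le_iff₀' hc]
  refine (sInf_negMinorantValues_le z (hF.smul_mem c hc.le u hu) fun x => ?_).trans_eq (by simp)
  simpa using mul_le_mul_of_nonneg_left (h x) hc.le

/-- The reverse inequality is the previous lemma applied to `c⁻¹` and `c • f`. -/
lemma sInf_negMinorantValues_smul (hF : IsConeWithConstants F) (z : K) {c : ℝ} (hc : 0 < c)
    (f : C(K, ℝ)) :
    sInf (negMinorantValues F z (c • f)) = c * sInf (negMinorantValues F z f) := by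
  refine le_antisymm (hF.sInf_negMinorantValues_smul_le z hc f) ?_
  have := hF.sInf_negMinorantValues_smul_le z (inv_pos.2 hc) (c • f)
  rwa [smul_smul, inv_mul_cancel₀ hc.ne', one_smul, inv_mul_eq_div, le_div_iff₀' hc] at this

lemma sInf_negMinorantValues_add_le (hF : IsConeWithConstants F) (z : K) (f g : C(K, ℝ)) :
    sInf (negMinorantValues F z (f + g)) ≤
      sInf (negMinorantValues F z f) + sInf (negMinorantValues F z g) := by
  rw [← sub_le_iff_le_add]
  refine le_csInf (hF.negMinorantValues_nonempty z f) ?_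
  rintro _ ⟨u, hu, hu', rfl⟩
  rw [sub_le_comm]
  refine le_csInf (hF.negMinorantValues_nonempty z g) ?_
  rintro _ ⟨w, hw, hw', rfl⟩
  have := sInf_negMinorantValues_le z (f := f + g) (hF.add_mem u hu w hw) fun x => by
    simpa [add_comm] using add_le_add (hu' x) (hw' x)
  simp only [Pi.add_apply] at this
  linarith

variable [T2Space K] [MeasurableSpace K] [BorelSpace K]

/-- A positive normalized linear functional on `C(K, ℝ)` is integration against a probability
measure. -/
lemma exists_probabilityMeasure_integral_eq (L : C(K, ℝ) →ₗ[ℝ] ℝ) (hL : ∀ f, 0 ≤ f → 0 ≤ L f)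
    (h1 : L 1 = 1) : ∃ μ : ProbabilityMeasure K, ∀ f : C(K, ℝ), ∫ x, f x ∂(μ : Measure K) = L f := by
  let Λ : CompactlySupportedContinuousMap K ℝ →ₚ[ℝ] ℝ :=
    { toFun := fun f => L f.toContinuousMap
      map_add' := fun f g => L.map_add f.toContinuousMap g.toContinuousMap
      map_smul' := fun c f => L.map_smul c f.toContinuousMap
      monotone' := fun f g hfg => by
        have := hL (g.toContinuousMap - f.toContinuousMap) (sub_nonneg.2 hfg)
        rwa [map_sub, sub_nonneg] at this }
  have hΛ : ∀ f : C(K, ℝ), ∫ x, f x ∂(RealRMK.rieszMeasure Λ) = L f := fun f =>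
    RealRMK.integral_rieszMeasure Λ ⟨f, HasCompactSupport.of_compactSpace _⟩
  have hp : IsProbabilityMeasure (RealRMK.rieszMeasure Λ) := by
    have h : (RealRMK.rieszMeasure Λ).real Set.univ = 1 := by
      simpa [h1] using hΛ 1
    exact ⟨by simpa [measureReal_def, ENNReal.toReal_eq_one_iff] using h⟩
  exact ⟨⟨_, hp⟩, hΛ⟩

/-- Edwards' theorem for continuous functions. -/
theorem exists_integral_le (hF : IsConeWithConstants F) (z : K) (f : C(K, ℝ)) {c : ℝ}
    (hc : ∀ u ∈ F, (∀ x, u x ≤ f x) → u z ≤ c) :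
    ∃ μ : ProbabilityMeasure K, (∀ u ∈ F, u z ≤ ∫ x, u x ∂(μ : Measure K)) ∧
      ∫ x, f x ∂(μ : Measure K) ≤ c := by
  set N : C(K, ℝ) → ℝ := fun g => sInf (negMinorantValues F z g) with hN
  have N0 : N 0 = 0 := by
    have h := hF.sInf_negMinorantValues_smul z (c := 2) (by norm_num) 0
    rw [smul_zero] at h
    change sInf _ = _
    linarith
  have hNf : -c ≤ N (-f) := by
    refine le_csInf (hF.negMinorantValues_nonempty z _) ?_
    rintro _ ⟨u, hu, h, rfl⟩
    exact neg_le_neg (hc u hu (by simpa using h))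
  have hNneg : 0 ≤ N (-f) + N f := by
    have := hF.sInf_negMinorantValues_add_le z (-f) f
    rw [neg_add_cancel] at this
    exact N0.symm.le.trans this
  obtain ⟨L, hLf, hLN⟩ : ∃ L : C(K, ℝ) →ₗ[ℝ] ℝ, L (-f) = N (-f) ∧ ∀ g, L g ≤ N g := by
    -- The functional on the line through `-f` is well defined even when `f = 0`, because `N 0 = 0`.
    have hspan : ∀ a : ℝ, a • (-f) = 0 → a • N (-f) = 0 := fun a ha => by
      rcases smul_eq_zero.1 ha with rfl | h
      · rw [zero_smul]
      · rw [h, N0, smul_zero]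
    obtain ⟨L, hL, hL'⟩ := exists_extension_of_le_sublinear
      (LinearPMap.mkSpanSingleton' (-f) (N (-f)) hspan) N
      (fun a ha g => hF.sInf_negMinorantValues_smul z ha g)
      (hF.sInf_negMinorantValues_add_le z) (by
        rintro ⟨x, hx⟩
        obtain ⟨a, rfl⟩ := Submodule.mem_span_singleton.1 hx
        rw [LinearPMap.mkSpanSingleton'_apply, smul_eq_mul]
        rcases lt_trichotomy a 0 with ha | rfl | ha
        -- Here `a • (-f) = (-a) • f` with `-a > 0`, so the bound amounts to `0 ≤ N (-f) + N f`.
        · have := hF.sInf_negMinorantValues_smul z (neg_pos.2 ha) f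
          rw [neg_smul, ← smul_neg] at this
          simp only [hN, RingHom.id_apply] at hNneg ⊢
          rw [this]
          nlinarith
        · simp [N0]
        · exact (hF.sInf_negMinorantValues_smul z ha (-f)).ge)
    exact ⟨L, (hL ⟨-f, Submodule.mem_span_singleton_self _⟩).trans
      (LinearPMap.mkSpanSingleton'_apply_self _ _ _ _), hL'⟩
  -- Since `u` is its own minorant, `L (-u) ≤ N (-u) ≤ -u z`.
  have hLF : ∀ u (hu : u ∈ F), u z ≤ L ⟨u, hF.continuous u hu⟩ := fun u hu => by
    have h := (hLN (-⟨u, hF.continuous u hu⟩)).trans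
      (sInf_negMinorantValues_le z hu fun x => by simp)
    rw [map_neg] at h
    linarith
  have hpos : ∀ g, 0 ≤ g → 0 ≤ L g := fun g hg => by
    have h := (hLN (-g)).trans (sInf_negMinorantValues_le z (hF.const_mem 0) fun x => by
      simpa using hg x)
    rw [map_neg] at h
    linarith
  -- Both constants `1` and `-1` lie in `F`, which bounds `L 1` from each side.
  have h1 : L 1 = 1 := by
    refine le_antisymm ?_ (hLF _ (hF.const_mem 1))
    have := hLF _ (hF.const_mem (-1))
    have h' : L ⟨fun _ => -1, hF.continuous _ (hF.const_mem (-1))⟩ = -L 1 := by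
      rw [← map_neg]; rfl
    linarith
  obtain ⟨μ, hμ⟩ := exists_probabilityMeasure_integral_eq L hpos h1
  refine ⟨μ, fun u hu => (hLF u hu).trans_eq (hμ ⟨u, hF.continuous u hu⟩).symm, ?_⟩
  rw [hμ f]
  rw [map_neg] at hLf
  linarith

end IsConeWithConstants

variable [CompactSpace K] [MeasurableSpace K] [BorelSpace K]

/-- Subtracting `g 0` makes everything nonnegative, so monotone convergence of `lintegral` first
bounds the integral of `φ - g 0`. The integrability so obtained is what the Bochner version needs.
-/
lemma integrable_and_integral_le_of_tendsto {μ : Measure K} [IsFiniteMeasure μ] {φ : K → ℝ}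
    {g : ℕ → C(K, ℝ)} (hg : Monotone g) (hgφ : ∀ k x, g k x ≤ φ x)
    (hlim : ∀ x, Filter.Tendsto (fun k => g k x) Filter.atTop (𝓝 (φ x))) {c : ℝ}
    (hc : ∀ k, ∫ x, g k x ∂μ ≤ c) : Integrable φ μ ∧ ∫ x, φ x ∂μ ≤ c := by
  have hgi : ∀ k, Integrable (g k) μ := fun k =>
    (g k).continuous.integrable_of_hasCompactSupport (HasCompactSupport.of_compactSpace _)
  have hmono : ∀ x, Monotone fun k => g k x := fun x i j hij => hg hij x
  have hφm : AEStronglyMeasurable φ μ := aestronglyMeasurable_of_tendsto_ae Filter.atTop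
    (fun k => (hgi k).aestronglyMeasurable) (Filter.Eventually.of_forall hlim)
  have hlint : Filter.Tendsto (fun k => ∫⁻ x, ENNReal.ofReal (g k x - g 0 x) ∂μ) Filter.atTop
      (𝓝 (∫⁻ x, ENNReal.ofReal (φ x - g 0 x) ∂μ)) := by
    refine lintegral_tendsto_of_tendsto_of_monotone (fun k => ?_) ?_ ?_
    · exact ((hgi k).sub (hgi 0)).aestronglyMeasurable.aemeasurable.ennreal_ofReal
    · exact Filter.Eventually.of_forall fun x i j hij =>
        ENNReal.ofReal_le_ofReal (sub_le_sub_right (hmono x hij) _)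
    · exact Filter.Eventually.of_forall fun x =>
        ENNReal.tendsto_ofReal ((hlim x).sub_const _)
  have hle : ∫⁻ x, ENNReal.ofReal (φ x - g 0 x) ∂μ ≤ ENNReal.ofReal (c - ∫ x, g 0 x ∂μ) := by
    refine le_of_tendsto' hlint fun k => ?_
    refine (ofReal_integral_eq_lintegral_ofReal ((hgi k).sub (hgi 0))
      (Filter.Eventually.of_forall fun x => sub_nonneg.2 (hmono x k.zero_le))).symm.trans_le ?_
    rw [integral_sub' (hgi k) (hgi 0)]
    exact ENNReal.ofReal_le_ofReal (sub_le_sub_right (hc k) _)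
  have hsub : Integrable (fun x => φ x - g 0 x) μ :=
    (lintegral_ofReal_ne_top_iff_integrable (hφm.sub (hgi 0).aestronglyMeasurable)
      (Filter.Eventually.of_forall fun x => sub_nonneg.2 (hgφ 0 x))).1
      (hle.trans_lt ENNReal.ofReal_lt_top).ne
  have hφi : Integrable φ μ := by simpa [Pi.add_def] using hsub.add (hgi 0)
  exact ⟨hφi, le_of_tendsto' (integral_tendsto_of_tendsto_of_monotone hgi hφi
    (Filter.Eventually.of_forall hmono) (Filter.Eventually.of_forall hlim)) hc⟩

namespace IsConeWithConstants

/-- Edwards' theorem for lower semicontinuous functions. -/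
theorem exists_integral_le_of_lowerSemicontinuous [T2Space K] [SecondCountableTopology K]
    (hF : IsConeWithConstants F) (z : K) {φ : K → ℝ} (hφ : LowerSemicontinuous φ) {c : ℝ}
    (hc : ∀ u ∈ F, (∀ x, u x ≤ φ x) → u z ≤ c) :
    ∃ μ : ProbabilityMeasure K, (∀ u ∈ F, u z ≤ ∫ x, u x ∂(μ : Measure K)) ∧
      Integrable φ (μ : Measure K) ∧ ∫ x, φ x ∂(μ : Measure K) ≤ c := by
  obtain ⟨g, hg, hgφ, hlim⟩ := exists_monotone_continuous_tendsto hφ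
  -- These sets are nonempty by the continuous case, decreasing because `g` increases, and weakly
  -- closed because integrals of continuous functions depend continuously on the measure.
  let T : ℕ → Set (ProbabilityMeasure K) := fun k =>
    {μ | (∀ u ∈ F, u z ≤ ∫ x, u x ∂(μ : Measure K)) ∧ ∫ x, g k x ∂(μ : Measure K) ≤ c}
  have hTc : ∀ k, IsClosed (T k) := fun k => by
    have hcont := fun f : C(K, ℝ) => ProbabilityMeasure.continuous_integral_continuousMap f
    have hT : T k = (⋂ u ∈ F, {μ : ProbabilityMeasure K | u z ≤ ∫ x, u x ∂(μ : Measure K)}) ∩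
        {μ : ProbabilityMeasure K | ∫ x, g k x ∂(μ : Measure K) ≤ c} := by
      ext μ
      simp [T]
    rw [hT]
    refine IsClosed.inter ?_ (isClosed_le (hcont (g k)) continuous_const)
    exact isClosed_iInter fun u => isClosed_iInter fun hu =>
      isClosed_le continuous_const (hcont ⟨u, hF.continuous u hu⟩)
  obtain ⟨μ, hμ⟩ := IsCompact.nonempty_iInter_of_sequence_nonempty_isCompact_isClosed T
    (fun k μ hμ => ⟨hμ.1, (integral_mono
      ((g k).continuous.integrable_of_hasCompactSupport (HasCompactSupport.of_compactSpace _))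
      ((g (k + 1)).continuous.integrable_of_hasCompactSupport
        (HasCompactSupport.of_compactSpace _)) (hg k.le_succ)).trans hμ.2⟩)
    (fun k => hF.exists_integral_le z (g k) fun u hu hug => hc u hu fun x =>
      (hug x).trans (hgφ k x))
    (hTc 0).isCompact hTc
  rw [Set.mem_iInter] at hμ
  exact ⟨μ, (hμ 0).1, integrable_and_integral_le_of_tendsto hg hgφ hlim fun k => (hμ k).2⟩

end IsConeWithConstants

end Edwards

/-! ### Application to `SHo` and `SH` -/

variable {n m : ℕ} {X : Set (Fin n → ℂ)}

lemma isConeWithConstants_SHo (hn : 0 < n) (m : ℕ) (X : Set (Fin n → ℂ)) :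
    IsConeWithConstants (SHo m X) where
  continuous _ := continuous_of_mem_SHo
  const_mem := const_mem_SHo hn m X
  add_mem _ hu _ hw := add_mem_SHo hn hu hw
  smul_mem _ hc _ hu := smul_mem_SHo hu hc

lemma coe_mem_SH_of_mem_SHo [CompactSpace X] {u : X → ℝ} (hu : u ∈ SHo m X) :
    (fun x => (u x : EReal)) ∈ SH m X := by
  have hc := continuous_of_mem_SHo hu
  refine ⟨(continuous_coe_real_ereal.comp hc).upperSemicontinuous,
    fun x => EReal.coe_lt_top _, fun z μ hμ => ?_⟩
  rw [eintegral_coe (hc.integrable_of_hasCompactSupport (HasCompactSupport.of_compactSpace _))]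
  exact EReal.coe_le_coe_iff.2 (hμ u hu)

end MSH

end

theorem theorem2p4 {n m : ℕ} (hm : 1 ≤ m) (hmn : m ≤ n) (X : Set (Fin n → ℂ)) (hX : IsCompact X)
    (φ : X → ℝ) (hφ : LowerSemicontinuous φ) (z : X) :
    ((⨆ ψ ∈ {ψ : X → ℝ | ψ ∈ MSH.SHo m X ∧ ∀ x, ψ x ≤ φ x}, (ψ z : EReal)) =
      ⨅ μ ∈ MSH.jensen m X z, MSH.eintegral (μ : Measure X) (fun x => (φ x : EReal))) ∧
    ((⨆ ψ ∈ {ψ : C(X, ℝ) | (fun x => (ψ x : EReal)) ∈ MSH.SH m X ∧ ∀ x, ψ x ≤ φ x},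
        (ψ z : EReal)) =
      ⨆ ψ ∈ {ψ : X → EReal | ψ ∈ MSH.SH m X ∧ ∀ x, ψ x ≤ (φ x : EReal)}, ψ z) ∧
    ((⨆ ψ ∈ {ψ : X → EReal | ψ ∈ MSH.SH m X ∧ ∀ x, ψ x ≤ (φ x : EReal)}, ψ z) =
      ⨅ μ ∈ MSH.jensen m X z, MSH.eintegral (μ : Measure X) (fun x => (φ x : EReal))) := by
  have hn : 0 < n := by omega
  have : CompactSpace X := isCompact_iff_compactSpace.1 hX
  set S₀ : EReal := ⨆ ψ ∈ {ψ : X → ℝ | ψ ∈ MSH.SHo m X ∧ ∀ x, ψ x ≤ φ x}, (ψ z : EReal) with hS₀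
  set S₁ : EReal := ⨆ ψ ∈ {ψ : C(X, ℝ) | (fun x => (ψ x : EReal)) ∈ MSH.SH m X ∧
    ∀ x, ψ x ≤ φ x}, (ψ z : EReal)
  set S₂ : EReal := ⨆ ψ ∈ {ψ : X → EReal | ψ ∈ MSH.SH m X ∧ ∀ x, ψ x ≤ (φ x : EReal)}, ψ z
  set I : EReal := ⨅ μ ∈ MSH.jensen m X z, MSH.eintegral (μ : Measure X) (fun x => (φ x : EReal))
  have h01 : S₀ ≤ S₁ := iSup₂_le fun ψ hψ =>
    le_iSup₂_of_le (⟨ψ, MSH.continuous_of_mem_SHo hψ.1⟩ : C(X, ℝ))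
      ⟨MSH.coe_mem_SH_of_mem_SHo hψ.1, hψ.2⟩ le_rfl
  have h12 : S₁ ≤ S₂ := iSup₂_le fun ψ hψ =>
    le_iSup₂_of_le (fun x => (ψ x : EReal))
      ⟨hψ.1, fun x => EReal.coe_le_coe_iff.2 (hψ.2 x)⟩ le_rfl
  have h2I : S₂ ≤ I := iSup₂_le fun ψ hψ => le_iInf₂ fun μ hμ =>
    (hψ.1.2.2 z μ hμ).trans (MSH.eintegral_mono hψ.2)
  have hI0 : I ≤ S₀ := by
    obtain ⟨M, hM⟩ := MSH.exists_le_of_lowerSemicontinuous hφ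
    -- `S₀` lies between a constant minorant of `φ` and `φ z`, so it is finite and can serve as the
    -- real bound `c` in Edwards' theorem.
    have hbot : S₀ ≠ ⊥ := ne_bot_of_le_ne_bot (EReal.coe_ne_bot M)
      (le_iSup₂_of_le (fun _ => M) ⟨MSH.const_mem_SHo hn m X M, hM⟩ le_rfl)
    have htop : S₀ ≠ ⊤ := ne_top_of_le_ne_top (EReal.coe_ne_top (φ z))
      (iSup₂_le fun ψ hψ => EReal.coe_le_coe_iff.2 (hψ.2 z))
    obtain ⟨μ, hμ, hφi, hle⟩ :=
      (MSH.isConeWithConstants_SHo hn m X).exists_integral_le_of_lowerSemicontinuous z hφ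
        (c := S₀.toReal) fun u hu huφ => EReal.coe_le_coe_iff.1 <| by
          rw [EReal.coe_toReal htop hbot]
          exact le_iSup₂_of_le (f := fun (ψ : X → ℝ) _ => (ψ z : EReal)) u ⟨hu, huφ⟩ le_rfl
    refine (iInf₂_le μ hμ).trans ?_
    rw [MSH.eintegral_coe hφi, ← EReal.coe_toReal htop hbot]
    exact EReal.coe_le_coe_iff.2 hle
  exact ⟨le_antisymm (h01.trans (h12.trans h2I)) hI0,
    le_antisymm h12 (h2I.trans (hI0.trans h01)),
    le_antisymm h2I (hI0.trans (h01.trans h12))⟩
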